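/- A series $\sum_{n=0}^\infty a_n$ of complex numbers is summable to $\beta$ by the Borel method $(\mathrm{B}')$ if the power series $\sum_{n=0}^\infty (a_n/n!)\,t^n$ converges for every $t$ and $\lim_{\lambda\to\infty}\int_0^\lambda e^{-t}\sum_{n=0}^\infty \frac{a_n}{n!}t^n\,dt=\beta$. A family of series $\sum_n a_n(\theta)$, $\theta\in S$, is uniformly $(\mathrm{B}')$ summable for $\theta\in S$ if each of them is $(\mathrm{B}')$ summable and the above limit is uniform in $\theta\in S$. An entire function $f$ is of exponential type if there are $C,\tau\ge 0$ with $|f(z)|\le C e^{\tau|z|}$ for all $z\in\mathbb{C}$, and its type is the infimum of all $\tau\ge 0$ for which such a $C$ exists. Let $f$ be an entire function. Then $f$ is of exponential type if and only if there exists $r>0$ such that the series $\sum_{n=0}^{\infty} f^{(n)}(0)\, r^n e^{in\theta}$ is uniformly $(\mathrm{B}')$ summable for $\theta\in[0,2\pi]$. Moreover, for every $r>0$ for which this series is uniformly $(\mathrm{B}')$ summable for $\theta\in[0,2\pi]$, the type of $f$ is at most $1/r$. -/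

import Mathlib

open Filter Topology
open scoped Nat NNReal ENNReal

noncomputable section

/-- The (formal) sum `∑ aₙ tⁿ / n!` attached to the series `∑ aₙ`. -/
def borelTransform (a : ℕ → ℂ) (t : ℂ) : ℂ :=
  ∑' n : ℕ, a n / (n ! : ℂ) * t ^ n

/-- The truncated Borel integral `∫₀^L e^{-t} (∑ aₙ tⁿ / n!) dt`. -/
def borelPartialIntegral (a : ℕ → ℂ) (L : ℝ) : ℂ :=
  ∫ t in (0 : ℝ)..L, (Real.exp (-t) : ℂ) * borelTransform a (t : ℂ)

/-- `∑ aₙ = β` in the sense of the Borel method (B′): the power series `∑ aₙ tⁿ / n!` converges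
for every `t`, and the improper integral `∫₀^∞ e^{-t} (∑ aₙ tⁿ / n!) dt` converges to `β`. -/
def HasBorelSum (a : ℕ → ℂ) (β : ℂ) : Prop :=
  (∀ t : ℂ, Summable fun n : ℕ => a n / (n ! : ℂ) * t ^ n) ∧
    Tendsto (borelPartialIntegral a) atTop (𝓝 β)

/-- A family of series `∑ₙ a x n` is uniformly (B′) summable for `x ∈ s`: each one is (B′)
summable, and the improper integrals converge uniformly for `x ∈ s`. -/
def UniformlyBorelSummableOn {X : Type*} (a : X → ℕ → ℂ) (s : Set X) : Prop :=
  ∃ β : X → ℂ, (∀ x ∈ s, HasBorelSum (a x) (β x)) ∧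
    TendstoUniformlyOn (fun (L : ℝ) (x : X) => borelPartialIntegral (a x) L) β atTop s

/-- `|f z| ≤ C e^{τ |z|}` on the whole plane, for some constant `C`. -/
def HasExpBound (f : ℂ → ℂ) (τ : ℝ≥0) : Prop :=
  ∃ C : ℝ, ∀ z : ℂ, ‖f z‖ ≤ C * Real.exp (τ * ‖z‖)

/-- `f` is of exponential type. -/
def IsOfExponentialType (f : ℂ → ℂ) : Prop :=
  ∃ τ : ℝ≥0, HasExpBound f τ

/-- The (exponential) type of `f`: the infimum of all `τ ≥ 0` with `f z = O(e^{τ |z|})`; it is `∞`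
when `f` is not of exponential type. -/
def exponentialType (f : ℂ → ℂ) : ℝ≥0∞ :=
  ⨅ (τ : ℝ≥0) (_ : HasExpBound f τ), (τ : ℝ≥0∞)

end

open MeasureTheory

/-! Summability here means convergence of `∫₀^∞ e^{-t} f(r e^{iθ} t) dt`. If `f z = O(e^{τ|z|})` and
`rτ < 1`, the integrand is dominated by `C e^{-(1 - rτ)t}`, which does not depend on `θ`, so
convergence is uniform. Conversely, uniform convergence bounds the truncated integrals by some `M`
for all `θ` and all large `L`. By Cauchy's formula and Fubini their `n`-th Fourier coefficient in
`θ` is `f⁽ⁿ⁾(0)/n! · rⁿ ∫₀^L e^{-t} tⁿ dt`, which tends to `f⁽ⁿ⁾(0) rⁿ`. Hence `|f⁽ⁿ⁾(0)| rⁿ ≤ M`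
(`norm_iteratedDeriv_mul_pow_le`), and the Taylor series gives `|f z| ≤ M e^{|z|/r}`: both the
converse and the bound on the type. -/

/-- The Borel transform of the series `∑ f⁽ⁿ⁾(0) rⁿ e^{inθ}` is `t ↦ f (r e^{iθ} t)`. -/
theorem hasSum_borelTransform {f : ℂ → ℂ} (hf : Differentiable ℂ f) (r θ : ℝ) (t : ℂ) :
    HasSum (fun n : ℕ => iteratedDeriv n f 0 * (r : ℂ) ^ n *
      Complex.exp (Complex.I * (n : ℂ) * (θ : ℂ)) / (n ! : ℂ) * t ^ n)
      (f (r * Complex.exp (Complex.I * θ) * t)) := by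
  have h := Complex.hasSum_taylorSeries_of_entire hf 0 (r * Complex.exp (Complex.I * θ) * t)
  refine h.congr_fun fun n => ?_
  have he : Complex.exp (Complex.I * (n : ℂ) * (θ : ℂ)) = Complex.exp (Complex.I * θ) ^ n := by
    rw [← Complex.exp_nat_mul]
    ring_nf
  simp only [smul_eq_mul, sub_zero, he, mul_pow]
  ring

theorem borelPartialIntegral_eq {f : ℂ → ℂ} (hf : Differentiable ℂ f) (r θ L : ℝ) :
    borelPartialIntegral (fun n : ℕ => iteratedDeriv n f 0 * (r : ℂ) ^ n *
      Complex.exp (Complex.I * (n : ℂ) * (θ : ℂ))) L =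
    ∫ t in (0 : ℝ)..L, (Real.exp (-t) : ℂ) * f (r * Complex.exp (Complex.I * θ) * t) := by
  simp only [borelPartialIntegral, borelTransform, (hasSum_borelTransform hf r θ _).tsum_eq]

/-- If `f z = O(e^{τ |z|})`, then the series is uniformly Borel summable on every circle of radius
`r < 1 / τ`. -/
theorem uniformlyBorelSummableOn_of_hasExpBound {f : ℂ → ℂ} (hf : Differentiable ℂ f)
    {τ : ℝ≥0} (h : HasExpBound f τ) {r : ℝ} (hr : 0 < r) (hτ : r * τ < 1) (s : Set ℝ) :
    UniformlyBorelSummableOn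
      (fun (θ : ℝ) (n : ℕ) =>
        iteratedDeriv n f 0 * (r : ℂ) ^ n * Complex.exp (Complex.I * (n : ℂ) * (θ : ℂ))) s := by
  obtain ⟨C, hC⟩ := h
  set δ : ℝ := 1 - r * τ with hδ
  have hδ0 : 0 < δ := by linarith
  let g : ℝ → ℝ → ℂ := fun θ t => (Real.exp (-t) : ℂ) * f (r * Complex.exp (Complex.I * θ) * t)
  have hgc (θ : ℝ) : Continuous (g θ) := by
    have := hf.continuous
    fun_prop
  have hg (θ t : ℝ) (ht : 0 ≤ t) : ‖g θ t‖ ≤ C * Real.exp (-δ * t) := by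
    have h1 := hC (r * Complex.exp (Complex.I * θ) * t)
    have h2 : ‖(r * Complex.exp (Complex.I * θ) * t : ℂ)‖ = r * t := by
      rw [norm_mul, norm_mul, mul_comm Complex.I, Complex.norm_exp_ofReal_mul_I,
        Complex.norm_of_nonneg hr.le, Complex.norm_of_nonneg ht, mul_one]
    rw [h2] at h1
    calc ‖g θ t‖ = Real.exp (-t) * ‖f (r * Complex.exp (Complex.I * θ) * t)‖ := by
          simp only [g, norm_mul, Complex.norm_of_nonneg (Real.exp_pos _).le]
      _ ≤ Real.exp (-t) * (C * Real.exp (τ * (r * t))) := by gcongr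
      _ = C * Real.exp (-δ * t) := by
          rw [mul_left_comm, ← Real.exp_add]
          congr 2
          rw [hδ]
          ring
  have hdom (c : ℝ) : IntegrableOn (fun t => C * Real.exp (-δ * t)) (Set.Ioi c) :=
    (integrableOn_exp_mul_Ioi (neg_lt_zero.2 hδ0) c).const_mul C
  have hint (θ : ℝ) : IntegrableOn (g θ) (Set.Ioi 0) := by
    refine (hdom 0).mono' (hgc θ).aestronglyMeasurable ?_
    filter_upwards [ae_restrict_mem measurableSet_Ioi] with t ht using hg θ t (le_of_lt ht)
  refine ⟨fun θ => ∫ t in Set.Ioi 0, g θ t, fun θ _ =>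
    ⟨fun t => (hasSum_borelTransform hf r θ t).summable, ?_⟩, ?_⟩
  · simp only [funext (borelPartialIntegral_eq hf r θ)]
    exact intervalIntegral_tendsto_integral_Ioi 0 (hint θ) tendsto_id
  · rw [Metric.tendstoUniformlyOn_iff]
    intro ε hε
    -- This is the tail `∫_L^∞` of the majorant, which controls the error for every `θ` at once.
    have hlim : Tendsto (fun L : ℝ => C * (-Real.exp (-δ * L) / -δ)) atTop (𝓝 0) := by
      have h1 : Tendsto (fun L : ℝ => Real.exp (-δ * L)) atTop (𝓝 0) :=
        Real.tendsto_exp_atBot.comp (tendsto_id.const_mul_atTop_of_neg (neg_lt_zero.2 hδ0))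
      simpa using ((h1.neg.div_const (-δ)).const_mul C)
    filter_upwards [hlim.eventually_lt_const hε, eventually_ge_atTop 0] with L hL hL0 θ _
    rw [borelPartialIntegral_eq hf r θ L, dist_eq_norm,
      ← intervalIntegral.integral_Ioi_sub_Ioi (hint θ) hL0, sub_sub_cancel]
    refine lt_of_le_of_lt (norm_integral_le_of_norm_le (hdom L) ?_) ?_
    · filter_upwards [ae_restrict_mem measurableSet_Ioi] with t ht
        using hg θ t (hL0.trans (le_of_lt ht))
    · rwa [integral_const_mul, integral_exp_mul_Ioi (neg_lt_zero.2 hδ0)]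

/-- Cauchy's formula: the Fourier coefficients of an entire function on a circle. -/
theorem integral_exp_mul_comp_circle {f : ℂ → ℂ} (hf : Differentiable ℂ f) {R : ℝ} (hR : 0 < R)
    (n : ℕ) :
    ∫ θ in (0 : ℝ)..2 * Real.pi,
      Complex.exp (-(Complex.I * n * θ)) * f (R * Complex.exp (Complex.I * θ)) =
    2 * Real.pi * (iteratedDeriv n f 0 / n !) * R ^ n := by
  have h := hf.differentiableOn.circleIntegral_one_div_sub_center_pow_smul (c := 0) hR n
  have hR' : (R : ℂ) ≠ 0 := by exact_mod_cast hR.ne'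
  have key (θ : ℝ) : Complex.exp (-(Complex.I * n * θ)) * f (R * Complex.exp (Complex.I * θ)) =
      ((R : ℂ) ^ n * (-Complex.I)) * (deriv (circleMap 0 R) θ •
        ((1 / (circleMap 0 R θ - 0) ^ (n + 1)) • f (circleMap 0 R θ))) := by
    have h1 : Complex.exp (-(Complex.I * n * θ)) = (Complex.exp (Complex.I * θ) ^ n)⁻¹ := by
      rw [Complex.exp_neg, ← Complex.exp_nat_mul]
      ring_nf
    have h2 : circleMap 0 R θ = R * Complex.exp (Complex.I * θ) := by
      rw [circleMap_zero, mul_comm Complex.I]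
    rw [deriv_circleMap, h2, h1, sub_zero]
    simp only [smul_eq_mul]
    have := Complex.exp_ne_zero (Complex.I * θ)
    field_simp
    rw [Complex.I_sq]
    ring
  simp only [key]
  rw [intervalIntegral.integral_const_mul]
  change _ * (∮ z in C(0, R), (1 / (z - 0) ^ (n + 1)) • f z) = _
  rw [h, smul_eq_mul]
  linear_combination (-(R : ℂ) ^ n * (2 * Real.pi * (iteratedDeriv n f 0 / n !))) * Complex.I_sq

/-- The Fourier coefficients in `θ` of the truncated Borel integrals of an entire function. -/
theorem integral_exp_mul_truncated {f : ℂ → ℂ} (hf : Differentiable ℂ f) {r L : ℝ} (hr : 0 < r)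
    (hL : 0 ≤ L) (n : ℕ) :
    ∫ θ in (0 : ℝ)..2 * Real.pi, Complex.exp (-(Complex.I * n * θ)) *
      ∫ t in (0 : ℝ)..L, (Real.exp (-t) : ℂ) * f (r * Complex.exp (Complex.I * θ) * t) =
    2 * Real.pi * (iteratedDeriv n f 0 / n !) * r ^ n *
      ((∫ t in (0 : ℝ)..L, Real.exp (-t) * t ^ n : ℝ) : ℂ) := by
  simp only [← intervalIntegral.integral_const_mul]
  rw [intervalIntegral_intervalIntegral_swap, ← intervalIntegral.integral_ofReal,
    ← intervalIntegral.integral_const_mul]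
  -- The half-open interval excludes `t = 0`, so the circle of radius `r t` is nondegenerate.
  · refine intervalIntegral.integral_congr_ae (.of_forall fun t ht => ?_)
    rw [Set.uIoc_of_le hL] at ht
    have h := integral_exp_mul_comp_circle hf (mul_pos hr ht.1) n
    calc _ = ∫ θ in (0 : ℝ)..2 * Real.pi, (Real.exp (-t) : ℂ) *
          (Complex.exp (-(Complex.I * n * θ)) *
            f ((r * t : ℝ) * Complex.exp (Complex.I * θ))) := by
          congr 1 with θ
          rw [Complex.ofReal_mul, mul_right_comm (r : ℂ)]
          ring
      _ = _ := by
          rw [intervalIntegral.integral_const_mul, h]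
          push_cast
          ring
  · have hc : Continuous (Function.uncurry fun (θ t : ℝ) => Complex.exp (-(Complex.I * n * θ)) *
        ((Real.exp (-t) : ℂ) * f (r * Complex.exp (Complex.I * θ) * t))) := by
      have := hf.continuous
      unfold Function.uncurry
      fun_prop
    exact (hc.continuousOn.integrableOn_compact
      (isCompact_uIcc.prod isCompact_uIcc)).mono_set
      (Set.prod_mono Set.uIoc_subset_uIcc Set.uIoc_subset_uIcc)

theorem tendsto_integral_exp_neg_mul_pow (n : ℕ) :
    Tendsto (fun L : ℝ => ∫ t in (0 : ℝ)..L, Real.exp (-t) * t ^ n) atTop (𝓝 (n ! : ℝ)) := by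
  have hn : (0 : ℝ) < n + 1 := by positivity
  have h1 := Real.GammaIntegral_convergent hn
  have h2 := Real.Gamma_eq_integral hn
  simp only [add_sub_cancel_right, Real.rpow_natCast] at h1 h2
  rw [← Real.Gamma_nat_eq_factorial, h2]
  exact intervalIntegral_tendsto_integral_Ioi 0 h1 tendsto_id

/-- Uniform Borel summability bounds the truncated integrals uniformly, from some point on. -/
theorem exists_bound_truncated {f : ℂ → ℂ} (hf : Differentiable ℂ f) {r : ℝ}
    (h : UniformlyBorelSummableOn
      (fun (θ : ℝ) (n : ℕ) =>
        iteratedDeriv n f 0 * (r : ℂ) ^ n * Complex.exp (Complex.I * (n : ℂ) * (θ : ℂ)))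
      (Set.Icc 0 (2 * Real.pi))) :
    ∃ M : ℝ, ∀ᶠ L : ℝ in atTop, ∀ θ ∈ Set.Icc 0 (2 * Real.pi),
      ‖∫ t in (0 : ℝ)..L, (Real.exp (-t) : ℂ) * f (r * Complex.exp (Complex.I * θ) * t)‖ ≤ M := by
  obtain ⟨β, -, hu⟩ := h
  rw [Metric.tendstoUniformlyOn_iff] at hu
  have hu1 := hu 1 one_pos
  -- No bound on `β` is available directly, so compare with one fixed cutoff `L₀`: that integral is
  -- continuous in `θ`, hence bounded by some `K`, and passing through `β` costs `1 + 1`.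
  obtain ⟨L₀, hL₀, h0⟩ := (hu1.and (eventually_ge_atTop 0)).exists
  have hc : Continuous fun θ : ℝ =>
      ∫ t in (0 : ℝ)..L₀, (Real.exp (-t) : ℂ) * f (r * Complex.exp (Complex.I * θ) * t) := by
    apply intervalIntegral.continuous_parametric_intervalIntegral_of_continuous'
    have := hf.continuous
    unfold Function.uncurry
    fun_prop
  obtain ⟨K, hK⟩ := isCompact_Icc.exists_bound_of_continuousOn
    (s := Set.Icc 0 (2 * Real.pi)) hc.continuousOn
  refine ⟨K + 2, hu1.mono fun L hL θ hθ => ?_⟩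
  have h1 := hL θ hθ
  have h2 := hL₀ θ hθ
  rw [borelPartialIntegral_eq hf r θ] at h1 h2
  have h3 := dist_triangle_left (∫ t in (0 : ℝ)..L, (Real.exp (-t) : ℂ) *
    f (r * Complex.exp (Complex.I * θ) * t)) (∫ t in (0 : ℝ)..L₀, (Real.exp (-t) : ℂ) *
    f (r * Complex.exp (Complex.I * θ) * t)) (β θ)
  rw [dist_eq_norm] at h3
  have h4 := norm_le_norm_add_norm_sub' (∫ t in (0 : ℝ)..L, (Real.exp (-t) : ℂ) *
    f (r * Complex.exp (Complex.I * θ) * t)) (∫ t in (0 : ℝ)..L₀, (Real.exp (-t) : ℂ) *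
    f (r * Complex.exp (Complex.I * θ) * t))
  linarith [hK θ hθ]

/-- Bounded truncated Borel integrals on a circle give Cauchy-type estimates for `f`. -/
theorem norm_iteratedDeriv_mul_pow_le {f : ℂ → ℂ} (hf : Differentiable ℂ f) {r M : ℝ} (hr : 0 < r)
    (hM : ∀ᶠ L : ℝ in atTop, ∀ θ ∈ Set.Icc 0 (2 * Real.pi),
      ‖∫ t in (0 : ℝ)..L, (Real.exp (-t) : ℂ) * f (r * Complex.exp (Complex.I * θ) * t)‖ ≤ M)
    (n : ℕ) : ‖iteratedDeriv n f 0‖ * r ^ n ≤ M := by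
  have hpi : (0 : ℝ) < 2 * Real.pi := by positivity
  have hfac : (n ! : ℝ) ≠ 0 := by positivity
  have hlim := (tendsto_integral_exp_neg_mul_pow n).const_mul
    (‖iteratedDeriv n f 0‖ / n ! * r ^ n)
  have hval : ‖iteratedDeriv n f 0‖ / n ! * r ^ n * n ! = ‖iteratedDeriv n f 0‖ * r ^ n := by
    field_simp
  rw [hval] at hlim
  -- It suffices to bound the Fourier coefficient for each large finite `L`.
  refine le_of_tendsto hlim ?_
  filter_upwards [hM, eventually_ge_atTop 0] with L hL hL0
  have hI : 0 ≤ ∫ t in (0 : ℝ)..L, Real.exp (-t) * t ^ n :=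
    intervalIntegral.integral_nonneg hL0 fun t ht => by
      have := ht.1
      positivity
  have hle := intervalIntegral.norm_integral_le_of_norm_le_const (a := 0) (b := 2 * Real.pi)
    (C := M) (f := fun θ : ℝ => Complex.exp (-(Complex.I * n * θ)) *
      ∫ t in (0 : ℝ)..L, (Real.exp (-t) : ℂ) * f (r * Complex.exp (Complex.I * θ) * t))
    fun θ hθ => by
      rw [Set.uIoc_of_le hpi.le] at hθ
      have h1 : ‖Complex.exp (-(Complex.I * n * θ))‖ = 1 := by
        simp [Complex.norm_exp]
      rw [norm_mul, h1, one_mul]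
      exact hL θ (Set.Ioc_subset_Icc_self hθ)
  rw [integral_exp_mul_truncated hf hr hL0, norm_mul, norm_mul, norm_mul, norm_mul, norm_div,
    norm_pow, Complex.norm_of_nonneg hI, Complex.norm_of_nonneg hr.le,
    Complex.norm_of_nonneg Real.pi_pos.le, Complex.norm_natCast, Complex.norm_ofNat, sub_zero,
    abs_of_pos hpi] at hle
  refine le_of_mul_le_mul_left ?_ hpi
  linarith

/-- The Taylor series is dominated termwise by `M` times the exponential series at `‖z‖ / r`. -/
theorem norm_le_mul_exp_of_norm_iteratedDeriv {f : ℂ → ℂ} (hf : Differentiable ℂ f) {r M : ℝ}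
    (hr : 0 < r) (h : ∀ n : ℕ, ‖iteratedDeriv n f 0‖ * r ^ n ≤ M) (z : ℂ) :
    ‖f z‖ ≤ M * Real.exp (1 / r * ‖z‖) := by
  have hs := Complex.hasSum_taylorSeries_of_entire hf 0 z
  have he : HasSum (fun n : ℕ => M * ((1 / r * ‖z‖) ^ n / n !)) (M * Real.exp (1 / r * ‖z‖)) := by
    rw [Real.exp_eq_exp_ℝ]
    exact (NormedSpace.expSeries_div_hasSum_exp (1 / r * ‖z‖)).mul_left M
  rw [← hs.tsum_eq]
  refine tsum_of_norm_bounded he fun n => ?_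
  rw [sub_zero, norm_smul, norm_smul, norm_inv, norm_pow, Complex.norm_natCast]
  calc (n ! : ℝ)⁻¹ * (‖z‖ ^ n * ‖iteratedDeriv n f 0‖)
      ≤ (n ! : ℝ)⁻¹ * (‖z‖ ^ n * (M / r ^ n)) := by
        gcongr
        rw [le_div_iff₀ (by positivity)]
        exact h n
    _ = M * ((1 / r * ‖z‖) ^ n / n !) := by
        rw [mul_pow, div_pow, one_pow]
        ring

/-- Uniform Borel summability on the circle of radius `r` forces `f z = O(e^{|z| / r})`. -/
theorem hasExpBound_of_uniformlyBorelSummableOn {f : ℂ → ℂ} (hf : Differentiable ℂ f) {r : ℝ}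
    (hr : 0 < r)
    (h : UniformlyBorelSummableOn
      (fun (θ : ℝ) (n : ℕ) =>
        iteratedDeriv n f 0 * (r : ℂ) ^ n * Complex.exp (Complex.I * (n : ℂ) * (θ : ℂ)))
      (Set.Icc 0 (2 * Real.pi))) :
    HasExpBound f (1 / r).toNNReal := by
  obtain ⟨M, hM⟩ := exists_bound_truncated hf h
  refine ⟨M, fun z => ?_⟩
  rw [Real.coe_toNNReal _ (by positivity)]
  exact norm_le_mul_exp_of_norm_iteratedDeriv hf hr (norm_iteratedDeriv_mul_pow_le hf hr hM) z

theorem corollary1 (f : ℂ → ℂ) (hf : Differentiable ℂ f) :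
    (IsOfExponentialType f ↔
      ∃ r : ℝ, 0 < r ∧
        UniformlyBorelSummableOn
          (fun (θ : ℝ) (n : ℕ) =>
            iteratedDeriv n f 0 * (r : ℂ) ^ n * Complex.exp (Complex.I * (n : ℂ) * (θ : ℂ)))
          (Set.Icc 0 (2 * Real.pi))) ∧
    ∀ r : ℝ, 0 < r →
      UniformlyBorelSummableOn
        (fun (θ : ℝ) (n : ℕ) =>
          iteratedDeriv n f 0 * (r : ℂ) ^ n * Complex.exp (Complex.I * (n : ℂ) * (θ : ℂ)))
        (Set.Icc 0 (2 * Real.pi)) →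
      exponentialType f ≤ ENNReal.ofReal (1 / r) := by
  refine ⟨⟨fun ⟨τ, hτ⟩ => ?_, fun ⟨r, hr, h⟩ =>
    ⟨_, hasExpBound_of_uniformlyBorelSummableOn hf hr h⟩⟩, fun r hr h =>
    iInf₂_le _ (hasExpBound_of_uniformlyBorelSummableOn hf hr h)⟩
  have hpos : (0 : ℝ) < τ + 1 := by positivity
  -- Using `τ + 1` gives `rτ < 1` and also covers `τ = 0`.
  refine ⟨1 / (τ + 1), by positivity,
    uniformlyBorelSummableOn_of_hasExpBound hf hτ (by positivity) ?_ _⟩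
  rw [one_div_mul_eq_div, div_lt_one hpos]
  linarith
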